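/- Let $\Gamma$ be the Grigorchuk group, i.e. the group of automorphisms of the rooted binary tree with vertex set $\{0,1\}^*$ generated by $a,b,c,d$, where $a(0w)=1w$, $a(1w)=0w$ and, recursively, $b(0w)=0a(w)$, $b(1w)=1c(w)$, $c(0w)=0a(w)$, $c(1w)=1d(w)$, $d(0w)=0w$, $d(1w)=1b(w)$. Let $K$ be the normal closure of $abab$ in $\Gamma$, let $\pi_K:\Gamma\to\Gamma/K$ be the projection, let $|g|$ be the word length of $g\in\Gamma$ with respect to $a,b,c,d$, and let $\mathcal S=\{g\in\Gamma: |g|\le 3\}$. Let $X$ be a countably infinite set of variables and let $F_X$ be the free group on $X$. A standard orientable quadratic equation with coefficients in $\mathcal S$ and with a constraint modulo $K$ is a pair $(Q=1,\gamma)$ where $$Q=[x_1,y_1]\cdots[x_g,y_g]\,z_1^{-1}c_1z_1\cdots z_m^{-1}c_mz_m \qquad (g,m\ge 0)$$ is a formal word with distinct variables $x_i,y_i,z_i\in X$ and with $c_i\in\mathcal S$, where $[x,y]=x^{-1}y^{-1}xy$, and where $\gamma$ is a map from the set $\mathrm{Var}(Q)$ of variables of $Q$ to $\Gamma/K$. A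 solution of it is a homomorphism $\alpha:\Gamma*F_X\to\Gamma$ which is the identity on $\Gamma$ and satisfies $\alpha(Q)=1$ and $\pi_K(\alpha(x))=\gamma(x)$ for all $x\in\mathrm{Var}(Q)$. Fix linear orders on $\Gamma/K$ and on $\mathcal S$. The equation is ordered if $$(\gamma(x_1),\gamma(y_1))\preceq\dots\preceq(\gamma(x_g),\gamma(y_g)),\qquad (c_1,\gamma(z_1))\preceq\dots\preceq(c_m,\gamma(z_m))$$ in the lexicographic orders. Let $\mathcal B=(\Gamma/K\times\Gamma/K)\sqcup(\Gamma/K\times\mathcal S)$. The code $\lambda_{Q,\gamma}\in\mathbb N^{\mathcal B}$ of an ordered equation takes $(g,h)\in\Gamma/K\times\Gamma/K$ to the number of $i$ with $\gamma(x_i)=g$, $\gamma(y_i)=h$, and $(g,c)\in\Gamma/K\times\mathcal S$ to the number of $i$ with $\gamma(z_i)=g$, $c_i=c$. Let $\mathcal P\subseteq\mathbb N^{\mathcal B}$ be the set of the codes of all ordered equations that have solutions. Fix a representative $\hat h\in\Gamma$ of each $h\in\Gamma/K$. Let $\mathcal L\subseteq\mathbb N^{\mathcal B}$ be the set of all linear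 combinations with coefficients in $\mathbb N$ of the functions $\mu_{g,h}$ $(g,h\in\Gamma/K)$ and $\nu_{g,c}$ $(g\in\Gamma/K,\ c\in\mathcal S)$, where $\mu_{g,h}$ takes $(g,h)$ to the order of $[\hat g,\hat h]$ and everything else to $0$, and $\nu_{g,c}$ takes $(g,c)$ to the order of $c$ and everything else to $0$. Then there are finitely many $v_1,\dots,v_k\in\mathbb N^{\mathcal B}$ such that $$\mathcal P=(v_1+\mathcal L)\cup\dots\cup(v_k+\mathcal L),$$ and $\mathcal P$ is recursive (the set $\mathcal B$ is finite, and membership in $\mathcal P$ is decidable by an algorithm). The same holds for standard non-orientable equations, that is, for the words $Q=x_1^2\cdots x_g^2\,z_1^{-1}c_1z_1\cdots z_m^{-1}c_mz_m$ with $g>0$, $m\ge 0$. Here $\gamma(x_1)\preceq\dots\preceq\gamma(x_g)$ replaces the first condition of orderedness, $\mathcal B$ becomes $(\Gamma/K)\sqcup(\Gamma/K\times\mathcal S)$, the code counts for each $g\in\Gamma/K$ the $i$ with $\gamma(x_i)=g$, and the functions $\mu_{g,h}$ are replaced by $\mu_g$ $(g\in\Gamma/K)$, where $\mu_g$ takes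 $g$ to the order of $\hat g^2$ and everything else to $0$. -/

import Mathlib

namespace GrigorchukEq

/-! ### Equations with constraints modulo a subgroup -/

/-- A letter of a word with coefficients in `G` and variables in `X`: an element of `G`, a variable
`x`, or a formal inverse `x⁻¹`. -/
inductive Letter (G X : Type*) where
  | const : G → Letter G X
  | var : X → Letter G X
  | inv : X → Letter G X

/-- The element of the free product `G * F_X` given by a letter. -/
def Letter.val {G X : Type*} [Group G] : Letter G X → Monoid.Coprod G (FreeGroup X)
  | .const g => Monoid.Coprod.inl g
  | .var x => Monoid.Coprod.inr (FreeGroup.of x)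
  | .inv x => (Monoid.Coprod.inr (FreeGroup.of x))⁻¹

/-- The element of `G * F_X` represented by a word. -/
def wordVal {G X : Type*} [Group G] (W : List (Letter G X)) : Monoid.Coprod G (FreeGroup X) :=
  (W.map Letter.val).prod

/-- `Var(W)`: the set of variables occurring in the word `W`. -/
def vars {G X : Type*} (W : List (Letter G X)) : Set X :=
  {x | Letter.var x ∈ W ∨ Letter.inv x ∈ W}

/-- `α` is a solution of the equation `W = 1` in `G` with constraint `γ : Var(W) → G/H`: it is a
`G`-homomorphism `G * F_X → G` with `α(W) = 1` and `α(x) H = γ(x)` for all `x ∈ Var(W)`. -/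
def IsSolution {G X : Type*} [Group G] {H : Subgroup G} (W : List (Letter G X))
    (γ : vars W → G ⧸ H) (α : Monoid.Coprod G (FreeGroup X) →* G) : Prop :=
  (∀ g : G, α (Monoid.Coprod.inl g) = g) ∧
  α (wordVal W) = 1 ∧
  ∀ x : vars W, (QuotientGroup.mk (α (Monoid.Coprod.inr (FreeGroup.of (x : X)))) : G ⧸ H) = γ x

/-- Solvability of the equation `W = 1` with constraint `γ`. -/
def Solvable {G X : Type*} [Group G] {H : Subgroup G} (W : List (Letter G X))
    (γ : vars W → G ⧸ H) : Prop :=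
  ∃ α : Monoid.Coprod G (FreeGroup X) →* G, IsSolution W γ α

/-! ### Standard quadratic words -/

/-- The product `z₁⁻¹ c₁ z₁ ⋯ z_m⁻¹ c_m z_m`. -/
def coeffPart {G X : Type*} {m : ℕ} (z : Fin m → X) (c : Fin m → G) : List (Letter G X) :=
  (List.finRange m).flatMap fun i => [.inv (z i), .const (c i), .var (z i)]

/-- The data of a standard orientable quadratic word
`[x₁,y₁] ⋯ [x_g,y_g] z₁⁻¹ c₁ z₁ ⋯ z_m⁻¹ c_m z_m`, with pairwise distinct variables. -/
structure Orientable (G X : Type*) where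
  genus : ℕ
  numCoeff : ℕ
  x : Fin genus → X
  y : Fin genus → X
  z : Fin numCoeff → X
  coeff : Fin numCoeff → G
  distinct : Function.Injective (Sum.elim x (Sum.elim y z))

/-- The standard orientable word itself; commutators are `[x,y] = x⁻¹ y⁻¹ x y`. -/
def Orientable.word {G X : Type*} (Q : Orientable G X) : List (Letter G X) :=
  ((List.finRange Q.genus).flatMap fun i =>
    [.inv (Q.x i), .inv (Q.y i), .var (Q.x i), .var (Q.y i)]) ++ coeffPart Q.z Q.coeff

/-- The data of a standard non-orientable quadratic word
`x₁² ⋯ x_g² z₁⁻¹ c₁ z₁ ⋯ z_m⁻¹ c_m z_m`, `g > 0`, with pairwise distinct variables. -/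
structure Nonorientable (G X : Type*) where
  genus : ℕ
  genus_pos : 0 < genus
  numCoeff : ℕ
  x : Fin genus → X
  z : Fin numCoeff → X
  coeff : Fin numCoeff → G
  distinct : Function.Injective (Sum.elim x z)

/-- The standard non-orientable word itself. -/
def Nonorientable.word {G X : Type*} (Q : Nonorientable G X) : List (Letter G X) :=
  ((List.finRange Q.genus).flatMap fun i => [.var (Q.x i), .var (Q.x i)]) ++
    coeffPart Q.z Q.coeff

theorem Orientable.x_mem {G X : Type*} (Q : Orientable G X) (i : Fin Q.genus) :
    Q.x i ∈ vars Q.word := by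
  left
  simp only [Orientable.word, List.mem_append, List.mem_flatMap]
  exact Or.inl ⟨i, List.mem_finRange i, by simp⟩

theorem Orientable.y_mem {G X : Type*} (Q : Orientable G X) (i : Fin Q.genus) :
    Q.y i ∈ vars Q.word := by
  left
  simp only [Orientable.word, List.mem_append, List.mem_flatMap]
  exact Or.inl ⟨i, List.mem_finRange i, by simp⟩

theorem Orientable.z_mem {G X : Type*} (Q : Orientable G X) (i : Fin Q.numCoeff) :
    Q.z i ∈ vars Q.word := by
  left
  simp only [Orientable.word, coeffPart, List.mem_append, List.mem_flatMap]
  exact Or.inr ⟨i, List.mem_finRange i, by simp⟩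

theorem Nonorientable.x_mem {G X : Type*} (Q : Nonorientable G X) (i : Fin Q.genus) :
    Q.x i ∈ vars Q.word := by
  left
  simp only [Nonorientable.word, List.mem_append, List.mem_flatMap]
  exact Or.inl ⟨i, List.mem_finRange i, by simp⟩

theorem Nonorientable.z_mem {G X : Type*} (Q : Nonorientable G X) (i : Fin Q.numCoeff) :
    Q.z i ∈ vars Q.word := by
  left
  simp only [Nonorientable.word, coeffPart, List.mem_append, List.mem_flatMap]
  exact Or.inr ⟨i, List.mem_finRange i, by simp⟩

/-! ### The Grigorchuk group -/

/-- The vertices of the binary tree are the words in `{0,1}`; `false` is `0`, `true` is `1`. -/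
def aFun : List Bool → List Bool
  | [] => []
  | x :: w => (!x) :: w

mutual
/-- `b(0w) = 0a(w)`, `b(1w) = 1c(w)`. -/
def bFun : List Bool → List Bool
  | [] => []
  | false :: w => false :: aFun w
  | true :: w => true :: cFun w
/-- `c(0w) = 0a(w)`, `c(1w) = 1d(w)`. -/
def cFun : List Bool → List Bool
  | [] => []
  | false :: w => false :: aFun w
  | true :: w => true :: dFun w
/-- `d(0w) = 0w`, `d(1w) = 1b(w)`. -/
def dFun : List Bool → List Bool
  | [] => []
  | false :: w => false :: w
  | true :: w => true :: bFun w
end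

theorem aFun_aFun : Function.Involutive aFun := by
  intro w
  cases w <;> simp [aFun]

theorem bcdFun_involutive (w : List Bool) :
    bFun (bFun w) = w ∧ cFun (cFun w) = w ∧ dFun (dFun w) = w := by
  induction w with
  | nil => simp [bFun, cFun, dFun]
  | cons x w ih =>
    obtain ⟨h1, h2, h3⟩ := ih
    have h0 := aFun_aFun w
    cases x <;> simp [bFun, cFun, dFun, h0, h1, h2, h3]

/-- The tree automorphisms `a, b, c, d`, as permutations of the set of vertices. -/
def permA : Equiv.Perm (List Bool) := Function.Involutive.toPerm aFun aFun_aFun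
def permB : Equiv.Perm (List Bool) :=
  Function.Involutive.toPerm bFun fun w => (bcdFun_involutive w).1
def permC : Equiv.Perm (List Bool) :=
  Function.Involutive.toPerm cFun fun w => (bcdFun_involutive w).2.1
def permD : Equiv.Perm (List Bool) :=
  Function.Involutive.toPerm dFun fun w => (bcdFun_involutive w).2.2

/-- The Grigorchuk group `Γ`, generated by `a, b, c, d`. -/
def Grig : Subgroup (Equiv.Perm (List Bool)) :=
  Subgroup.closure {permA, permB, permC, permD}

def genA : Grig := ⟨permA, Subgroup.subset_closure (by simp)⟩
def genB : Grig := ⟨permB, Subgroup.subset_closure (by simp)⟩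
def genC : Grig := ⟨permC, Subgroup.subset_closure (by simp)⟩
def genD : Grig := ⟨permD, Subgroup.subset_closure (by simp)⟩

/-- `K` is the normal closure of `abab` in `Γ`. -/
def K : Subgroup Grig := Subgroup.normalClosure {genA * genB * genA * genB}

instance : K.Normal := by
  unfold K
  infer_instance

/-- The word length `|g|` with respect to `a, b, c, d` (these are involutions, so that inverses of
generators are not needed in words). -/
noncomputable def wordLength (g : Grig) : ℕ :=
  sInf {n | ∃ l : List Grig, (∀ s ∈ l, s ∈ ({genA, genB, genC, genD} : Set Grig)) ∧
    l.prod = g ∧ l.length = n}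

/-- The set `𝒮` of elements of length at most `3`. -/
def Short : Set Grig := {g | wordLength g ≤ 3}

/-! ### Codes of ordered equations, orientable case -/

/-- The index set `𝓑 = (Γ/K × Γ/K) ∪ (Γ/K × 𝒮)`. -/
abbrev B : Type := ((Grig ⧸ K) × (Grig ⧸ K)) ⊕ ((Grig ⧸ K) × Short)

/-- A standard orientable quadratic equation over `Γ` with coefficients in `𝒮` and with a
constraint modulo `K`. -/
structure OrientableEq (X : Type*) where
  Q : Orientable Grig X
  short : ∀ i, Q.coeff i ∈ Short
  γ : vars Q.word → Grig ⧸ K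

namespace OrientableEq

variable {X : Type*} (E : OrientableEq X)

/-- The values `γ(x_i)`, `γ(y_i)`, `γ(z_i)` and the coefficients `c_i`. -/
def gx (i : Fin E.Q.genus) : Grig ⧸ K := E.γ ⟨E.Q.x i, E.Q.x_mem i⟩
def gy (i : Fin E.Q.genus) : Grig ⧸ K := E.γ ⟨E.Q.y i, E.Q.y_mem i⟩
def gz (i : Fin E.Q.numCoeff) : Grig ⧸ K := E.γ ⟨E.Q.z i, E.Q.z_mem i⟩
def c (i : Fin E.Q.numCoeff) : Short := ⟨E.Q.coeff i, E.short i⟩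

/-- Both sequences `(γ(x_i), γ(y_i))` and `(c_i, γ(z_i))` are lexicographically non-decreasing. -/
def IsOrdered [LinearOrder (Grig ⧸ K)] [LinearOrder Short] : Prop :=
  Monotone (fun i => toLex (E.gx i, E.gy i)) ∧ Monotone (fun i => toLex (E.c i, E.gz i))

/-- The code: the number of factors `[x_i,y_i]` with `γ(x_i) = g`, `γ(y_i) = h`, and the number of
factors `z_i⁻¹ c_i z_i` with `γ(z_i) = g`, `c_i = c`. -/
noncomputable def code : B → ℕ
  | .inl (g, h) => Nat.card {i // E.gx i = g ∧ E.gy i = h}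
  | .inr (g, c) => Nat.card {i // E.gz i = g ∧ E.c i = c}

end OrientableEq

/-- The set `𝒫` of the codes of the ordered equations that have solutions. -/
def codes (X : Type*) [LinearOrder (Grig ⧸ K)] [LinearOrder Short] : Set (B → ℕ) :=
  {f | ∃ E : OrientableEq X, E.IsOrdered ∧ Solvable E.Q.word E.γ ∧ E.code = f}

open Classical in
/-- The vector which at `(g,h) ∈ Γ/K × Γ/K` is `n_u λ_u` with `n_u` the order of `[ĝ,ĥ]`, and at
`(g,c) ∈ Γ/K × 𝒮` with `n_u` the order of `c`. Here `ĝ = r g` is the chosen representative. -/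
noncomputable def basicVec (r : Grig ⧸ K → Grig) : B → (B → ℕ)
  | .inl (g, h) => Pi.single (.inl (g, h)) (orderOf ((r g)⁻¹ * (r h)⁻¹ * r g * r h))
  | .inr (g, c) => Pi.single (.inr (g, c)) (orderOf (c : Grig))

/-- The cone `𝓛` of all combinations of the basic vectors with coefficients in `ℕ`. -/
def cone (r : Grig ⧸ K → Grig) : AddSubmonoid (B → ℕ) :=
  AddSubmonoid.closure (Set.range (basicVec r))

/-! ### Codes of ordered equations, non-orientable case -/

/-- The index set `(Γ/K) ∪ (Γ/K × 𝒮)`. -/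
abbrev B' : Type := (Grig ⧸ K) ⊕ ((Grig ⧸ K) × Short)

/-- A standard non-orientable quadratic equation over `Γ` with coefficients in `𝒮` and with a
constraint modulo `K`. -/
structure NonorientableEq (X : Type*) where
  Q : Nonorientable Grig X
  short : ∀ i, Q.coeff i ∈ Short
  γ : vars Q.word → Grig ⧸ K

namespace NonorientableEq

variable {X : Type*} (E : NonorientableEq X)

def gx (i : Fin E.Q.genus) : Grig ⧸ K := E.γ ⟨E.Q.x i, E.Q.x_mem i⟩
def gz (i : Fin E.Q.numCoeff) : Grig ⧸ K := E.γ ⟨E.Q.z i, E.Q.z_mem i⟩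
def c (i : Fin E.Q.numCoeff) : Short := ⟨E.Q.coeff i, E.short i⟩

/-- The sequence `γ(x_i)` is non-decreasing and `(c_i, γ(z_i))` is so lexicographically. -/
def IsOrdered [LinearOrder (Grig ⧸ K)] [LinearOrder Short] : Prop :=
  Monotone (fun i => E.gx i) ∧ Monotone (fun i => toLex (E.c i, E.gz i))

/-- The code: the number of factors `x_i²` with `γ(x_i) = g`, and the number of factors
`z_i⁻¹ c_i z_i` with `γ(z_i) = g`, `c_i = c`. -/
noncomputable def code : B' → ℕ
  | .inl g => Nat.card {i // E.gx i = g}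
  | .inr (g, c) => Nat.card {i // E.gz i = g ∧ E.c i = c}

end NonorientableEq

/-- The set of the codes of the ordered non-orientable equations that have solutions. -/
def codes' (X : Type*) [LinearOrder (Grig ⧸ K)] [LinearOrder Short] : Set (B' → ℕ) :=
  {f | ∃ E : NonorientableEq X, E.IsOrdered ∧ Solvable E.Q.word E.γ ∧ E.code = f}

open Classical in
/-- As `basicVec`, with the order of `ĝ²` in place of the order of `[ĝ,ĥ]`. -/
noncomputable def basicVec' (r : Grig ⧸ K → Grig) : B' → (B' → ℕ)
  | .inl g => Pi.single (.inl g) (orderOf ((r g) ^ 2))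
  | .inr (g, c) => Pi.single (.inr (g, c)) (orderOf (c : Grig))

/-- The cone of all combinations of the vectors `basicVec'` with coefficients in `ℕ`. -/
def cone' (r : Grig ⧸ K → Grig) : AddSubmonoid (B' → ℕ) :=
  AddSubmonoid.closure (Set.range (basicVec' r))

/-! ### Recursive sets of vectors -/

/-- A set of vectors in `ℕ^ι` is recursive if `ι` is finite and, for every enumeration of `ι`,
membership in the set is decided by a computable function of the coordinates. -/
def IsRecursive {ι : Type*} (P : Set (ι → ℕ)) : Prop :=
  Finite ι ∧ ∀ (n : ℕ) (e : ι ≃ Fin n), ComputablePred fun f : Fin n → ℕ => (f ∘ e) ∈ P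

end GrigorchukEq

namespace GrigorchukEq

/-! ### Sets of vectors closed under adding multiples of the unit vectors -/

-- Solvable codes are closed under adding basic vectors. Distinct variables may take equal values,
-- so a block of `n` factors all evaluated at the same representatives contributes the `n`-th power
-- of one element. If `n` is the order of that element, the block is trivial. It can be inserted
-- where the list of factors stays sorted, and the code then grows by one basic vector
-- (`add_single_mem_codes`, `add_single_mem_codes'`).
--
-- The rest is Dickson's lemma. `Γ` is a torsion group (`Grig.isOfFinOrder`), so every basic vector
-- is a positive multiple `n u` of a unit vector. On a fixed class of residues modulo the `n u`,
-- differing by an element of the cone is the same as the product order on `ℕ^ι`. There are finitely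
-- many classes because `Γ/K` and `𝒮` are finite, and each contains finitely many minimal codes.
-- These minimal codes are the `v_i` (`exists_eq_iUnion_image_add`).
--
-- A finite union of translated cones is described by inequalities and congruences on the
-- coordinates, hence is recursive. The decision procedure exists because finitely many `v_i` exist;
-- the argument gives no way to compute them.

theorem mem_closure_range_single {ι : Type*} [Finite ι] [DecidableEq ι] (n l : ι → ℕ) :
    l ∈ AddSubmonoid.closure (Set.range fun u => (Pi.single u (n u) : ι → ℕ)) ↔
      ∀ u, n u ∣ l u := by
  constructor
  · intro hl u
    induction hl using AddSubmonoid.closure_induction with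
    | mem x hx =>
      obtain ⟨v, rfl⟩ := hx
      by_cases h : u = v
      · subst h; simp
      · simp [Pi.single_eq_of_ne h]
    | zero => simp
    | add x y _ _ hx hy => exact dvd_add hx hy
  · intro h
    cases nonempty_fintype ι
    rw [← Finset.univ_sum_single l]
    refine AddSubmonoid.sum_mem _ fun u _ => ?_
    obtain ⟨k, hk⟩ := h u
    have : (Pi.single u (l u) : ι → ℕ) = k • Pi.single u (n u) := by
      rw [← Pi.single_smul, hk, smul_eq_mul, mul_comm]
    rw [this]
    exact AddSubmonoid.nsmul_mem _ (AddSubmonoid.subset_closure (Set.mem_range_self u)) k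

theorem add_mem_of_add_single_mem {ι : Type*} [DecidableEq ι] {n : ι → ℕ}
    {P : Set (ι → ℕ)} (hP : ∀ f ∈ P, ∀ u, f + Pi.single u (n u) ∈ P) {f l : ι → ℕ} (hf : f ∈ P)
    (hl : l ∈ AddSubmonoid.closure (Set.range fun u => (Pi.single u (n u) : ι → ℕ))) :
    f + l ∈ P := by
  induction hl using AddSubmonoid.closure_induction generalizing f with
  | mem x hx => obtain ⟨v, rfl⟩ := hx; exact hP f hf v
  | zero => simpa
  | add x y _ _ hx hy => rw [← add_assoc]; exact hy (hx hf)

/-- Dickson's lemma for the order relation given by a cone of multiples of unit vectors. -/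
theorem exists_eq_iUnion_image_add {ι : Type*} [Finite ι] [DecidableEq ι] {n : ι → ℕ}
    (hn : ∀ u, 0 < n u) {P : Set (ι → ℕ)} (hP : ∀ f ∈ P, ∀ u, f + Pi.single u (n u) ∈ P) :
    ∃ (m : ℕ) (v : Fin m → ι → ℕ), P = ⋃ i, (fun l => v i + l) ''
      (AddSubmonoid.closure (Set.range fun u => (Pi.single u (n u) : ι → ℕ)) : Set (ι → ℕ)) := by
  set L := AddSubmonoid.closure (Set.range fun u => (Pi.single u (n u) : ι → ℕ)) with hL
  -- The elements of `P` that are minimal when `g` is below `f` if `f - g` lies in the cone.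
  let M : Set (ι → ℕ) := {f ∈ P | ∀ g ∈ P, ∀ l ∈ L, f = g + l → f = g}
  have key : ∀ f g : ι → ℕ, (∀ u, f u % n u = g u % n u) → f ≤ g → ∃ l ∈ L, g = f + l := by
    intro f g h hle
    refine ⟨g - f, ?_, (add_tsub_cancel_of_le hle).symm⟩
    rw [hL, mem_closure_range_single]
    intro u
    exact (Nat.modEq_iff_dvd' (hle u)).1 (h u)
  have hM : M.Finite := by
    have hsub : M ⊆ ⋃ ρ : (u : ι) → Fin (n u), {f ∈ M | ∀ u, f u % n u = ρ u} := by
      intro f hf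
      exact Set.mem_iUnion.2 ⟨fun u => ⟨f u % n u, Nat.mod_lt _ (hn u)⟩, hf, fun u => rfl⟩
    refine (Set.finite_iUnion fun ρ => ?_).subset hsub
    -- Within a residue class, comparable elements differ by an element of the cone, so minimal ones
    -- form an antichain, and antichains in `ℕ^ι` are finite.
    refine IsAntichain.finite_of_partiallyWellOrderedOn (r := (· ≤ ·)) ?_
      (Set.isPWO_of_wellQuasiOrderedLE _)
    intro f hf g hg hne hle
    obtain ⟨l, hl, h⟩ := key f g (fun u => (hf.2 u).trans (hg.2 u).symm) hle
    exact hne (hg.1.2 f hf.1.1 l hl h).symm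
  have hmin : ∀ f ∈ P, ∃ g ∈ M, ∃ l ∈ L, f = g + l := by
    intro f
    induction f using WellFoundedLT.induction with
    | ind f ih =>
      intro hf
      by_cases h : f ∈ M
      · exact ⟨f, h, 0, L.zero_mem, by simp⟩
      · have h' : ∃ g ∈ P, ∃ l ∈ L, f = g + l ∧ f ≠ g := by
          by_contra hc
          push Not at hc
          exact h ⟨hf, hc⟩
        obtain ⟨g, hg, l, hl, hfg, hne⟩ := h'
        have hlt : g < f := lt_of_le_of_ne (hfg ▸ le_self_add) hne.symm
        obtain ⟨g', hg', l', hl', rfl⟩ := ih g hlt hg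
        exact ⟨g', hg', l' + l, L.add_mem hl' hl, by rw [hfg, add_assoc]⟩
  obtain ⟨m, v, -, hv⟩ := hM.fin_param
  refine ⟨m, v, ?_⟩
  ext f
  simp only [Set.mem_iUnion, Set.mem_image, SetLike.mem_coe]
  constructor
  · intro hf
    obtain ⟨g, hg, l, hl, rfl⟩ := hmin f hf
    rw [← hv] at hg
    obtain ⟨i, rfl⟩ := hg
    exact ⟨i, l, hl, rfl⟩
  · rintro ⟨i, l, hl, rfl⟩
    have : v i ∈ M := hv ▸ Set.mem_range_self i
    exact add_mem_of_add_single_mem hP this.1 hl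

-- Recursiveness of finite unions of translated cones

/-- Either truth value gives a constant function, so no procedure deciding `p` is needed. This is
the base case for the finite conjunctions and disjunctions below. -/
theorem primrecPred_const {α : Type*} [Primcodable α] (p : Prop) : PrimrecPred fun _ : α => p := by
  by_cases h : p
  · exact ⟨fun _ => isTrue h, (Primrec.const true).of_eq fun _ => by simp [h]⟩
  · exact ⟨fun _ => isFalse h, (Primrec.const false).of_eq fun _ => by simp [h]⟩

theorem primrecPred_forall_mem_finset {α β : Type*} [Primcodable α] (s : Finset β)
    {p : β → α → Prop} (hp : ∀ i, PrimrecPred (p i)) :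
    PrimrecPred fun a => ∀ i ∈ s, p i a := by
  classical
  induction s using Finset.induction_on with
  | empty => exact (primrecPred_const True).of_eq fun _ => by simp
  | insert i s _ ih => exact ((hp i).and ih).of_eq fun a => by simp

theorem primrecPred_exists_mem_finset {α β : Type*} [Primcodable α] (s : Finset β)
    {p : β → α → Prop} (hp : ∀ i, PrimrecPred (p i)) :
    PrimrecPred fun a => ∃ i ∈ s, p i a := by
  classical
  induction s using Finset.induction_on with
  | empty => exact (primrecPred_const False).of_eq fun _ => by simp
  | insert i s _ ih => exact ((hp i).or ih).of_eq fun a => by simp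

/-- A finite union of translates of a cone of multiples of unit vectors is recursive. -/
theorem isRecursive_iUnion_image_add {ι : Type*} [Finite ι] [DecidableEq ι] (n : ι → ℕ) {m : ℕ}
    (v : Fin m → ι → ℕ) : IsRecursive (⋃ i, (fun l => v i + l) ''
      (AddSubmonoid.closure (Set.range fun u => (Pi.single u (n u) : ι → ℕ)) :
        Set (ι → ℕ))) := by
  refine ⟨inferInstance, fun k e => ?_⟩
  -- The numbers `v i _` and `n _` are fixed, so they enter as constants and need not be computed
  -- from anything.
  have hp : PrimrecPred fun f : Fin k → ℕ => ∃ i ∈ (Finset.univ : Finset (Fin m)),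
      ∀ u ∈ (Finset.univ : Finset (Fin k)),
        v i (e.symm u) ≤ f u ∧ (f u - v i (e.symm u)) % n (e.symm u) = 0 := by
    refine primrecPred_exists_mem_finset _ fun i => primrecPred_forall_mem_finset _ fun u => ?_
    have hu : Primrec fun f : Fin k → ℕ => f u := Primrec.fin_app.comp .id (.const u)
    exact (Primrec.nat_le.comp (.const _) hu).and (Primrec.eq.comp
      (Primrec.nat_mod.comp (Primrec.nat_sub.comp hu (.const _)) (.const _)) (.const 0))
  obtain ⟨hd, hp⟩ := hp.of_eq (q := fun f : Fin k → ℕ => (f ∘ e) ∈ ⋃ i, (fun l => v i + l) ''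
      (AddSubmonoid.closure (Set.range fun u => (Pi.single u (n u) : ι → ℕ)) :
        Set (ι → ℕ))) (fun f => by
    simp only [Set.mem_iUnion, Set.mem_image, SetLike.mem_coe, mem_closure_range_single,
      Finset.mem_univ, true_and, true_implies]
    refine exists_congr fun i => ⟨fun h => ⟨f ∘ e - v i, fun u => ?_, ?_⟩, ?_⟩
    · simpa using Nat.dvd_of_mod_eq_zero (h (e u)).2
    · exact add_tsub_cancel_of_le fun u => by simpa using (h (e u)).1
    · rintro ⟨l, hl, h⟩ u
      have h' : v i (e.symm u) + l (e.symm u) = f u := by simpa using congrFun h (e.symm u)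
      rw [← h']
      exact ⟨Nat.le_add_right _ _, by simpa using Nat.mod_eq_zero_of_dvd (hl (e.symm u))⟩)
  exact ⟨hd, hp.to_comp⟩


/-! ### The Grigorchuk group is a torsion group -/

theorem bcdFun_mul (w : List Bool) :
    (bFun (cFun w) = dFun w ∧ cFun (bFun w) = dFun w) ∧
    (bFun (dFun w) = cFun w ∧ dFun (bFun w) = cFun w) ∧
    (cFun (dFun w) = bFun w ∧ dFun (cFun w) = bFun w) := by
  induction w with
  | nil => simp [bFun, cFun, dFun]
  | cons x w ih =>
    have h0 := aFun_aFun w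
    cases x <;> simp [bFun, cFun, dFun, h0, ih]

-- Words, weights and alternating form

/-- The generators of `Γ` other than `a`. -/
inductive Gen
  | b | c | d

/-- The tree automorphism given by a generator other than `a`. -/
def Gen.perm : Gen → Equiv.Perm (List Bool)
  | .b => permB
  | .c => permC
  | .d => permD

/-- Words in the generators; `none` stands for `a`. -/
def evalWord (w : List (Option Gen)) : Equiv.Perm (List Bool) :=
  (w.map fun s => s.elim permA Gen.perm).prod

@[simp] theorem evalWord_nil : evalWord [] = 1 := rfl

@[simp] theorem evalWord_cons (s : Option Gen) (w : List (Option Gen)) :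
    evalWord (s :: w) = s.elim permA Gen.perm * evalWord w := rfl

@[simp] theorem evalWord_append (v w : List (Option Gen)) :
    evalWord (v ++ w) = evalWord v * evalWord w := by
  simp [evalWord]

theorem permA_mul_self : permA * permA = 1 := Equiv.ext aFun_aFun

theorem Gen.perm_mul_self (x : Gen) : x.perm * x.perm = 1 := by
  cases x
  exacts [Equiv.ext fun w => (bcdFun_involutive w).1, Equiv.ext fun w => (bcdFun_involutive w).2.1,
    Equiv.ext fun w => (bcdFun_involutive w).2.2]

theorem evalWord_reverse (w : List (Option Gen)) : evalWord w.reverse = (evalWord w)⁻¹ := by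
  induction w with
  | nil => simp
  | cons s w ih =>
    have : (s.elim permA Gen.perm)⁻¹ = s.elim permA Gen.perm := by
      rw [inv_eq_iff_mul_eq_one]
      cases s
      exacts [permA_mul_self, Gen.perm_mul_self _]
    simp [ih, this]

/-- Weights for which the two sections of `ax` together are lighter than `ax`, for every generator
`x ≠ a`. -/
def Gen.weight : Gen → ℕ
  | .b => 4
  | .c => 3
  | .d => 2

/-- The weight of a word, where `a` has weight `3`. -/
def weight (w : List (Option Gen)) : ℕ :=
  (w.map fun s => s.elim 3 Gen.weight).sum

@[simp] theorem weight_nil : weight [] = 0 := rfl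

@[simp] theorem weight_cons (s : Option Gen) (w : List (Option Gen)) :
    weight (s :: w) = s.elim 3 Gen.weight + weight w := rfl

@[simp] theorem weight_append (v w : List (Option Gen)) :
    weight (v ++ w) = weight v + weight w := by
  simp [weight]

theorem Gen.weight_pos (x : Gen) : 0 < x.weight := by
  cases x <;> decide

/-- `b, c, d` and the identity form a Klein four-group, and the weights `4, 3, 2` satisfy the strict
triangle inequality. -/
theorem Gen.exists_mul (x y : Gen) : ∃ p : Option Gen,
    x.perm * y.perm = p.elim 1 Gen.perm ∧ p.elim 0 Gen.weight < x.weight + y.weight := by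
  by_cases h : x = y
  · subst h
    exact ⟨none, x.perm_mul_self, by simpa using x.weight_pos⟩
  · cases x <;> cases y <;> first | exact absurd rfl h | skip
    · exact ⟨some .d, Equiv.ext fun w => (bcdFun_mul w).1.1, by decide⟩
    · exact ⟨some .c, Equiv.ext fun w => (bcdFun_mul w).2.1.1, by decide⟩
    · exact ⟨some .d, Equiv.ext fun w => (bcdFun_mul w).1.2, by decide⟩
    · exact ⟨some .b, Equiv.ext fun w => (bcdFun_mul w).2.2.1, by decide⟩
    · exact ⟨some .c, Equiv.ext fun w => (bcdFun_mul w).2.1.2, by decide⟩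
    · exact ⟨some .b, Equiv.ext fun w => (bcdFun_mul w).2.2.2, by decide⟩

/-- The alternating word `a x₁ a x₂ ⋯ a x_k`. -/
def altWord (v : List Gen) : List (Option Gen) := v.flatMap fun x => [none, some x]

@[simp] theorem altWord_nil : altWord [] = [] := rfl

@[simp] theorem altWord_cons (x : Gen) (v : List Gen) :
    altWord (x :: v) = none :: some x :: altWord v := rfl

@[simp] theorem altWord_append (u v : List Gen) : altWord (u ++ v) = altWord u ++ altWord v := by
  simp [altWord]

/-- Every word can be replaced, without increasing its weight, by an alternating one. -/
theorem exists_alternating (w : List (Option Gen)) : ∃ (p : Option Gen) (v : List Gen) (q : Bool),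
    evalWord w = p.elim 1 Gen.perm * evalWord (altWord v) * (if q then permA else 1) ∧
    p.elim 0 Gen.weight + weight (altWord v) + (if q then 3 else 0) ≤ weight w := by
  induction w with
  | nil => exact ⟨none, [], false, by simp, by simp⟩
  | cons s w ih =>
    obtain ⟨p, v, q, he, hw⟩ := ih
    cases s with
    | some y =>
      cases p with
      | none =>
        exact ⟨some y, v, q, by simp [he, mul_assoc], by simp at hw ⊢; omega⟩
      | some x =>
        obtain ⟨p, hp, hlt⟩ := y.exists_mul x
        exact ⟨p, v, q, by simp [he, ← hp, mul_assoc], by simp at hw ⊢; omega⟩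
    | none =>
      cases p with
      | some x =>
        exact ⟨none, x :: v, q, by simp [he, mul_assoc], by simp at hw ⊢; omega⟩
      | none =>
        cases v with
        | nil =>
          cases q
          · exact ⟨none, [], true, by simp [he], by simp at hw ⊢⟩
          · exact ⟨none, [], false, by simp [he, permA_mul_self], by simp at hw ⊢⟩
        | cons x v =>
          -- The new `a` cancels the leading `a` of the alternating word and frees `x`.
          refine ⟨some x, v, q, ?_, by simp at hw ⊢; omega⟩
          simp only [evalWord_cons, he, altWord_cons, Option.elim, one_mul]
          simp only [← mul_assoc, permA_mul_self, one_mul]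

-- Sections at the first level of the tree

/-- The section of a generator other than `a` at a vertex of the first level. -/
def Gen.childWord : Bool → Gen → List (Option Gen)
  | false, .b => [none]
  | true, .b => [some .c]
  | false, .c => [none]
  | true, .c => [some .d]
  | false, .d => []
  | true, .d => [some .b]

theorem Gen.perm_cons (x : Gen) (β : Bool) (u : List Bool) :
    x.perm (β :: u) = β :: evalWord (Gen.childWord β x) u := by
  cases x <;> cases β <;>
    simp [Gen.perm, Gen.childWord, permA, permB, permC, permD, Function.Involutive.toPerm,
      bFun, cFun, dFun]

theorem permA_cons (β : Bool) (u : List Bool) : permA (β :: u) = (!β) :: u := rfl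

/-- The image of a vertex of the first level under an alternating word. -/
def altVertex (v : List Gen) (β : Bool) : Bool := v.foldr (fun _ => not) β

/-- The section of an alternating word at a vertex of the first level. -/
def altSection (β : Bool) : List Gen → List (Option Gen)
  | [] => []
  | x :: v => Gen.childWord (altVertex v β) x ++ altSection β v

theorem evalWord_altWord_cons (v : List Gen) (β : Bool) (u : List Bool) :
    evalWord (altWord v) (β :: u) = altVertex v β :: evalWord (altSection β v) u := by
  induction v with
  | nil => simp [altVertex, altSection]
  | cons x v ih =>
    simp [Equiv.Perm.mul_apply, ih, Gen.perm_cons, permA_cons, altSection, altVertex]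

theorem altVertex_not (v : List Gen) (β : Bool) : altVertex v (!β) = !altVertex v β := by
  induction v with
  | nil => rfl
  | cons x v ih => simp only [altVertex, List.foldr_cons] at ih ⊢; rw [ih]

/-- The two sections together receive both children of each letter `x`, since the two vertices of
the first level stay different. The pair `ax` weighs `7`, `6`, `5` for `x = b, c, d`, while the
children weigh `3 + 3`, `3 + 2`, `0 + 4` in total: a loss of `1` per letter. -/
theorem weight_altSection_add_le (v : List Gen) :
    weight (altSection false v) + weight (altSection true v) + v.length ≤
      weight (altWord v) := by
  induction v with
  | nil => simp [altSection]
  | cons x v ih =>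
    have h := altVertex_not v false
    simp only [Bool.not_false] at h
    simp only [altSection, h, weight_append, altWord_cons, weight_cons, List.length_cons]
    cases x <;> cases altVertex v false <;> simp [Gen.childWord, Gen.weight] <;> omega

-- Torsion by contraction of weights

theorem pow_cons_of_forall {g h : Equiv.Perm (List Bool)} {β : Bool}
    (H : ∀ u, g (β :: u) = β :: h u) (n : ℕ) (u : List Bool) :
    (g ^ n) (β :: u) = β :: (h ^ n) u := by
  induction n generalizing u with
  | zero => simp
  | succ n ih => rw [pow_succ, pow_succ, Equiv.Perm.mul_apply, H, ih, Equiv.Perm.mul_apply]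

/-- Elements of the ambient group are arbitrary permutations of the vertices, so sections determine
them only once the root is known to be fixed. -/
theorem evalWord_apply_nil (w : List (Option Gen)) : evalWord w [] = [] := by
  induction w with
  | nil => rfl
  | cons s w ih =>
    rw [evalWord_cons, Equiv.Perm.mul_apply, ih]
    rcases s with _ | _ | _ | _ <;>
      simp [Gen.perm, permA, permB, permC, permD, Function.Involutive.toPerm, aFun, bFun, cFun, dFun]

theorem isOfFinOrder_of_sections {g h₀ h₁ : Equiv.Perm (List Bool)} (hnil : g [] = [])
    (H₀ : ∀ u, g (false :: u) = false :: h₀ u) (H₁ : ∀ u, g (true :: u) = true :: h₁ u)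
    (h₀fin : IsOfFinOrder h₀) (h₁fin : IsOfFinOrder h₁) : IsOfFinOrder g := by
  obtain ⟨m, hm, hm'⟩ := h₀fin.exists_pow_eq_one
  obtain ⟨n, hn, hn'⟩ := h₁fin.exists_pow_eq_one
  refine isOfFinOrder_iff_pow_eq_one.2 ⟨m * n, Nat.mul_pos hm hn, Equiv.ext fun w => ?_⟩
  rcases w with _ | ⟨_ | _, u⟩
  · exact Function.IsFixedPt.perm_pow hnil _
  · rw [pow_cons_of_forall H₀, pow_mul, hm', one_pow]; rfl
  · rw [pow_cons_of_forall H₁, mul_comm, pow_mul, hn', one_pow]; rfl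

theorem isOfFinOrder_mul_comm {G : Type*} [Group G] {x y : G} (h : IsOfFinOrder (x * y)) :
    IsOfFinOrder (y * x) := by
  refine IsConj.isOfFinOrder (isConj_iff.2 ⟨y, ?_⟩) h
  group

/-- If the first-level vertices are fixed, both sections are lighter than the word. If they are
swapped, the square fixes them and its sections are the two products of the original sections; each
has the total weight of both sections, still less than that of the word. -/
theorem isOfFinOrder_evalWord_altWord {v : List Gen} (hv : v ≠ [])
    (ih : ∀ w, weight w < weight (altWord v) → IsOfFinOrder (evalWord w)) :
    IsOfFinOrder (evalWord (altWord v)) := by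
  have hle := weight_altSection_add_le v
  have hlen := List.length_pos_iff.2 hv
  have hnot := altVertex_not v false
  have hnil := evalWord_apply_nil (altWord v)
  have h₀ := evalWord_altWord_cons v false
  have h₁ := evalWord_altWord_cons v true
  set s₀ := altSection false v
  set s₁ := altSection true v
  rw [Bool.not_false] at hnot
  rw [hnot] at h₁
  cases hβ : altVertex v false <;> rw [hβ] at h₀ h₁
  · exact isOfFinOrder_of_sections hnil h₀ h₁ (ih _ (by omega)) (ih _ (by omega))
  · refine IsOfFinOrder.of_pow (n := 2) ?_ two_ne_zero
    refine isOfFinOrder_of_sections (h₀ := evalWord (s₁ ++ s₀)) (h₁ := evalWord (s₀ ++ s₁))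
      (Function.IsFixedPt.perm_pow hnil _) (fun u => ?_) (fun u => ?_)
      (ih _ (by rw [weight_append]; omega)) (ih _ (by rw [weight_append]; omega))
    · rw [pow_two, Equiv.Perm.mul_apply, h₀, h₁, evalWord_append]; rfl
    · rw [pow_two, Equiv.Perm.mul_apply, h₁, Bool.not_true, h₀, evalWord_append]; rfl

theorem isOfFinOrder_of_mul_self {G : Type*} [Group G] {x : G} (h : x * x = 1) :
    IsOfFinOrder x :=
  isOfFinOrder_iff_pow_eq_one.2 ⟨2, two_pos, by rw [pow_two, h]⟩

theorem isOfFinOrder_evalWord (w : List (Option Gen)) : IsOfFinOrder (evalWord w) := by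
  induction hn : weight w using Nat.strong_induction_on generalizing w with
  | _ n ih =>
    subst hn
    replace ih : ∀ w', weight w' < weight w → IsOfFinOrder (evalWord w') :=
      fun w' h => ih _ h w' rfl
    obtain ⟨p, v, q, he, hw⟩ := exists_alternating w
    rw [he]
    have alt : ∀ v : List Gen, weight (altWord v) ≤ weight w →
        IsOfFinOrder (evalWord (altWord v)) := fun v hv => by
      by_cases hv' : v = []
      · subst hv'; exact IsOfFinOrder.one
      · exact isOfFinOrder_evalWord_altWord hv' fun w' h => ih w' (h.trans_le hv)
    rcases p with _ | x
    · rcases q with _ | _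
      · simpa using alt v (by simpa using hw)
      · rcases v with _ | ⟨x, v⟩
        · simpa using isOfFinOrder_of_mul_self permA_mul_self
        -- Conjugating by `a` cancels the two outer letters `a`.
        · have := ih (some x :: altWord v) (by simp at hw ⊢; omega)
          refine isOfFinOrder_mul_comm ?_
          simpa [← mul_assoc, permA_mul_self] using this
    · rcases q with _ | _
      · rcases List.eq_nil_or_concat v with rfl | ⟨v, y, rfl⟩
        · simpa using isOfFinOrder_of_mul_self x.perm_mul_self
        -- Cyclically, the first letter `x` meets the last letter `y`, and their product is lighter.
        · obtain ⟨p, hp, hlt⟩ := y.exists_mul x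
          have := ih (altWord v ++ none :: p.toList.map some) (by
            cases p <;> simp at hw hlt ⊢ <;> omega)
          have e : evalWord (altWord v ++ none :: p.toList.map some) =
              evalWord (altWord v) * permA * y.perm * x.perm := by
            rw [mul_assoc _ y.perm, hp]
            cases p <;> simp [mul_assoc]
          rw [e] at this
          simpa [mul_assoc] using isOfFinOrder_mul_comm this
      -- Moving `x` cyclically to the end gives an alternating word of the same weight.
      · have := alt (v ++ [x]) (by simp at hw ⊢; omega)
        refine isOfFinOrder_mul_comm (x := _ * permA) ?_
        simpa [mul_assoc] using this

theorem exists_evalWord_eq {g : Equiv.Perm (List Bool)} (hg : g ∈ Grig) :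
    ∃ w, evalWord w = g := by
  induction hg using Subgroup.closure_induction with
  | mem x hx =>
    rcases hx with rfl | rfl | rfl | rfl
    exacts [⟨[none], by simp⟩, ⟨[some .b], by simp [Gen.perm]⟩, ⟨[some .c], by simp [Gen.perm]⟩,
      ⟨[some .d], by simp [Gen.perm]⟩]
  | one => exact ⟨[], rfl⟩
  | mul x y _ _ hx hy =>
    obtain ⟨v, rfl⟩ := hx
    obtain ⟨w, rfl⟩ := hy
    exact ⟨v ++ w, evalWord_append v w⟩
  | inv x _ hx =>
    obtain ⟨w, rfl⟩ := hx
    exact ⟨w.reverse, evalWord_reverse w⟩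

theorem Grig.isOfFinOrder (g : Grig) : IsOfFinOrder g := by
  obtain ⟨w, hw⟩ := exists_evalWord_eq g.2
  rw [← Submonoid.isOfFinOrder_coe]
  change IsOfFinOrder (g : Equiv.Perm (List Bool))
  rw [← hw]
  exact isOfFinOrder_evalWord w

/-! ### Finiteness of the index sets -/

theorem genB_mul_genD : genB * genD = genC :=
  Subtype.ext (Equiv.ext fun w => (bcdFun_mul w).2.1.1)

theorem genD_mul_genB : genD * genB = genC :=
  Subtype.ext (Equiv.ext fun w => (bcdFun_mul w).2.1.2)

theorem genA_mul_self : genA * genA = 1 := Subtype.ext permA_mul_self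

theorem genB_mul_self : genB * genB = 1 := Subtype.ext (Gen.perm_mul_self .b)

theorem genD_mul_self : genD * genD = 1 := Subtype.ext (Gen.perm_mul_self .d)

theorem exists_list_prod_eq (g : Grig) :
    ∃ l : List Grig, (∀ s ∈ l, s ∈ ({genA, genB, genC, genD} : Set Grig)) ∧ l.prod = g := by
  obtain ⟨w, hw⟩ := exists_evalWord_eq g.2
  induction w generalizing g with
  | nil => exact ⟨[], by simp, Subtype.ext hw⟩
  | cons s w ih =>
    obtain ⟨t, ht, hts⟩ : ∃ t : Grig, t ∈ ({genA, genB, genC, genD} : Set Grig) ∧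
        (t : Equiv.Perm (List Bool)) = s.elim permA Gen.perm := by
      rcases s with _ | _ | _ | _
      exacts [⟨genA, by simp, rfl⟩, ⟨genB, by simp, rfl⟩, ⟨genC, by simp, rfl⟩,
        ⟨genD, by simp, rfl⟩]
    obtain ⟨l, hl, hlg⟩ := ih (t⁻¹ * g) (by
      rw [Subgroup.coe_mul, Subgroup.coe_inv, hts, ← hw, evalWord_cons, inv_mul_cancel_left])
    exact ⟨t :: l, List.forall_mem_cons.2 ⟨ht, hl⟩, by simp [hlg]⟩

instance : Finite Short := by
  let G := {s : Grig // s ∈ ({genA, genB, genC, genD} : Set Grig)}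
  have : Finite G := (Set.toFinite ({genA, genB, genC, genD} : Set Grig)).to_subtype
  have hfin : {l : List G | l.length ≤ 3}.Finite := List.finite_length_le G 3
  refine Set.Finite.subset (hfin.image fun l => (l.map Subtype.val).prod) ?_
  intro g hg
  obtain ⟨l₀, hl₀, rfl⟩ := exists_list_prod_eq g
  -- The infimum of the empty set is `0`, so a bound on `wordLength` says something only because
  -- every element is a product of generators.
  obtain ⟨l, hl, hlg, hlen⟩ := Nat.sInf_mem
    (s := {n | ∃ l : List Grig, (∀ s ∈ l, s ∈ ({genA, genB, genC, genD} : Set Grig)) ∧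
      l.prod = l₀.prod ∧ l.length = n}) ⟨l₀.length, l₀, hl₀, rfl, rfl⟩
  lift l to List G using hl
  refine ⟨l, ?_, hlg⟩
  have h3 : wordLength l₀.prod ≤ 3 := hg
  rw [List.length_map] at hlen
  exact hlen.trans_le h3

instance : Finite (Grig ⧸ K) := by
  let A : Grig ⧸ K := QuotientGroup.mk genA
  let B : Grig ⧸ K := QuotientGroup.mk genB
  let D : Grig ⧸ K := QuotientGroup.mk genD
  have hA : A * A = 1 := congrArg QuotientGroup.mk genA_mul_self
  have hB : B * B = 1 := congrArg QuotientGroup.mk genB_mul_self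
  have hD : D * D = 1 := congrArg QuotientGroup.mk genD_mul_self
  have hBD : B * D = QuotientGroup.mk genC := congrArg QuotientGroup.mk genB_mul_genD
  have hDB : D * B = QuotientGroup.mk genC := congrArg QuotientGroup.mk genD_mul_genB
  have hBD' : Commute B D := hBD.trans hDB.symm
  have hAB : Commute A B := by
    have h : A * B * A * B = 1 :=
      (QuotientGroup.eq_one_iff _).2 (Subgroup.subset_normalClosure rfl)
    have hA' : A⁻¹ = A := inv_eq_of_mul_eq_one_left hA
    have hB' : B⁻¹ = B := inv_eq_of_mul_eq_one_left hB
    calc A * B = (A * B)⁻¹ := (inv_eq_of_mul_eq_one_left (by rw [← h]; group)).symm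
      _ = B * A := by rw [mul_inv_rev, hA', hB']
  have hu : IsOfFinOrder (A * D) :=
    (QuotientGroup.mk' K).isOfFinOrder (Grig.isOfFinOrder (genA * genD))
  -- Normal form in `Γ/K`: a power of `AD`, then `1` or `A`, then `1` or `B`. Torsion bounds the
  -- powers; `A` and `D` generate a dihedral group, and `B` commutes with both.
  let T : Set (Grig ⧸ K) := (fun z : (Grig ⧸ K) × (Grig ⧸ K) × (Grig ⧸ K) => z.1 * z.2.1 * z.2.2) ''
    ((Subgroup.zpowers (A * D) : Set (Grig ⧸ K)) ×ˢ ({1, A} : Set (Grig ⧸ K)) ×ˢ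
      ({1, B} : Set (Grig ⧸ K)))
  have hT : T.Finite := by
    have : (Subgroup.zpowers (A * D) : Set (Grig ⧸ K)).Finite := hu.finite_zpowers
    exact (this.prod ((Set.toFinite _).prod (Set.toFinite _))).image _
  have hAu : ∀ t ∈ Subgroup.zpowers (A * D), ∃ t' ∈ Subgroup.zpowers (A * D), A * t = t' * A := by
    rintro _ ⟨i, rfl⟩
    -- Conjugation by the involution `A` inverts `AD`.
    refine ⟨(A * (A * D) * A⁻¹) ^ i, Subgroup.zpow_mem _ ?_ i, ?_⟩
    · rw [← inv_mem_iff]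
      have : (A * (A * D) * A⁻¹)⁻¹ = A * D := by
        rw [inv_eq_iff_mul_eq_one]
        calc A * (A * D) * A⁻¹ * (A * D) = (A * A) * (D * D) := by group
          _ = 1 := by rw [hA, hD, one_mul]
      rw [this]
      exact Subgroup.mem_zpowers _
    · rw [conj_zpow]; group
  have hTA : ∀ t ∈ T, A * t ∈ T := by
    rintro _ ⟨⟨t, p, q⟩, ⟨ht, hp, hq⟩, rfl⟩
    obtain ⟨t', ht', h⟩ := hAu t ht
    refine ⟨⟨t', A * p, q⟩, ⟨ht', ?_, hq⟩, ?_⟩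
    · rcases hp with rfl | rfl
      · simp
      · simp [hA]
    · simp only [← mul_assoc, h]
  have hTu : ∀ t ∈ T, A * D * t ∈ T := by
    rintro _ ⟨⟨t, p, q⟩, ⟨ht, hp, hq⟩, rfl⟩
    exact ⟨⟨A * D * t, p, q⟩, ⟨mul_mem (Subgroup.mem_zpowers _) ht, hp, hq⟩,
      by simp only [mul_assoc]⟩
  have hTD : ∀ t ∈ T, D * t ∈ T := fun t ht => by
    have := hTA _ (hTu t ht)
    rwa [← mul_assoc, ← mul_assoc, hA, one_mul] at this
  have hTB : ∀ t ∈ T, B * t ∈ T := by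
    rintro _ ⟨⟨t, p, q⟩, ⟨ht, hp, hq⟩, rfl⟩
    refine ⟨⟨t, p, B * q⟩, ⟨ht, hp, ?_⟩, ?_⟩
    · rcases hq with rfl | rfl
      · simp
      · simp [hB]
    · obtain ⟨i, rfl⟩ := ht
      have h1 : Commute B ((A * D) ^ i) := (hAB.symm.mul_right hBD').zpow_right i
      have h2 : Commute B p := by
        rcases hp with rfl | rfl
        exacts [Commute.one_right _, hAB.symm]
      change (A * D) ^ i * p * (B * q) = B * ((A * D) ^ i * p * q)
      rw [← mul_assoc, ← mul_assoc B, (h1.mul_right h2).eq]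
  have huniv : ∀ z : Grig ⧸ K, z ∈ T := by
    intro z
    induction z using QuotientGroup.induction_on with
    | H g =>
      obtain ⟨l, hl, rfl⟩ := exists_list_prod_eq g
      induction l with
      | nil => exact ⟨⟨1, 1, 1⟩, ⟨one_mem _, by simp, by simp⟩, by simp⟩
      | cons s l ih =>
        have ih' := ih fun s hs => hl s (List.mem_cons_of_mem _ hs)
        rw [List.prod_cons]
        rcases hl s List.mem_cons_self with rfl | rfl | rfl | rfl
        · exact hTA _ ih'
        · exact hTB _ ih'
        · have := hTB _ (hTD _ ih')
          rwa [← mul_assoc, hBD] at this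
        · exact hTD _ ih'
  exact Set.finite_univ_iff.1 (hT.subset fun z _ => huniv z)


/-! ### Evaluation of standard quadratic words -/

theorem wordVal_append {G X : Type*} [Group G] (V W : List (Letter G X)) :
    wordVal (V ++ W) = wordVal V * wordVal W := by
  simp [wordVal]

theorem wordVal_flatMap {ι G X : Type*} [Group G] (l : List ι) (F : ι → List (Letter G X)) :
    wordVal (l.flatMap F) = (l.map fun i => wordVal (F i)).prod := by
  induction l with
  | nil => rfl
  | cons i l ih => rw [List.flatMap_cons, wordVal_append, ih, List.map_cons, List.prod_cons]

/-- The value of a variable under a homomorphism `G * F_X → G`. -/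
def varVal {G X : Type*} [Group G] (α : Monoid.Coprod G (FreeGroup X) →* G) (x : X) : G :=
  α (Monoid.Coprod.inr (FreeGroup.of x))

/-- The commutator `x⁻¹ y⁻¹ x y` of a pair. -/
def pairComm {G : Type*} [Group G] (p : G × G) : G := p.1⁻¹ * p.2⁻¹ * p.1 * p.2

/-- The conjugate `z⁻¹ c z`. -/
def pairConj {G : Type*} [Group G] (q : G × G) : G := q.1⁻¹ * q.2 * q.1

theorem map_wordVal_coeffPart {G X : Type*} [Group G] {α : Monoid.Coprod G (FreeGroup X) →* G}
    (hα : ∀ g, α (Monoid.Coprod.inl g) = g) {m : ℕ} (z : Fin m → X) (c : Fin m → G) :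
    α (wordVal (coeffPart z c)) =
      (List.ofFn fun i => pairConj (varVal α (z i), c i)).prod := by
  rw [coeffPart, wordVal_flatMap, map_list_prod, List.map_map, List.ofFn_eq_map]
  congr 2
  funext i
  simp [wordVal, Letter.val, pairConj, varVal, hα, mul_assoc]

theorem Orientable.map_wordVal {G X : Type*} [Group G] {α : Monoid.Coprod G (FreeGroup X) →* G}
    (hα : ∀ g, α (Monoid.Coprod.inl g) = g) (Q : Orientable G X) :
    α (wordVal Q.word) =
      (List.ofFn fun i => pairComm (varVal α (Q.x i), varVal α (Q.y i))).prod *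
        (List.ofFn fun i => pairConj (varVal α (Q.z i), Q.coeff i)).prod := by
  rw [Orientable.word, wordVal_append, map_mul, map_wordVal_coeffPart hα, wordVal_flatMap,
    map_list_prod, List.map_map, List.ofFn_eq_map (n := Q.genus)]
  congr 3
  funext i
  simp [wordVal, Letter.val, pairComm, varVal, mul_assoc]

theorem Nonorientable.map_wordVal {G X : Type*} [Group G]
    {α : Monoid.Coprod G (FreeGroup X) →* G} (hα : ∀ g, α (Monoid.Coprod.inl g) = g)
    (Q : Nonorientable G X) :
    α (wordVal Q.word) = (List.ofFn fun i => varVal α (Q.x i) ^ 2).prod *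
      (List.ofFn fun i => pairConj (varVal α (Q.z i), Q.coeff i)).prod := by
  rw [Nonorientable.word, wordVal_append, map_mul, map_wordVal_coeffPart hα, wordVal_flatMap,
    map_list_prod, List.map_map, List.ofFn_eq_map (n := Q.genus)]
  congr 3
  funext i
  simp [wordVal, Letter.val, varVal, pow_two]

/-- The `G`-homomorphism `G * F_X → G` with given values on the variables. -/
def homOfVal {G X : Type*} [Group G] (val : X → G) : Monoid.Coprod G (FreeGroup X) →* G :=
  Monoid.Coprod.lift (MonoidHom.id G) (FreeGroup.lift val)

@[simp] theorem homOfVal_inl {G X : Type*} [Group G] (val : X → G) (g : G) :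
    homOfVal val (Monoid.Coprod.inl g) = g := by
  simp [homOfVal]

@[simp] theorem varVal_homOfVal {G X : Type*} [Group G] (val : X → G) (x : X) :
    varVal (homOfVal val) x = val x := by
  simp [homOfVal, varVal]

/-! ### Codes in terms of lists of values -/

open Classical in
/-- The number of entries of a list with a given property. -/
noncomputable def countWhere {α : Type*} (P : α → Prop) (l : List α) : ℕ :=
  l.countP fun a => decide (P a)

theorem card_subtype_eq_countWhere_ofFn {α : Type*} {n : ℕ} (F : Fin n → α) (P : α → Prop) :
    Nat.card {i // P (F i)} = countWhere P (List.ofFn F) := by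
  classical
  rw [countWhere, Nat.card_eq_fintype_card, Fintype.card_subtype, List.ofFn_eq_map,
    List.countP_map, List.countP_eq_length_filter]
  simp only [Finset.card_def, Finset.filter_val]
  change (Multiset.filter _ (List.finRange n : Multiset (Fin n))).card = _
  rw [Multiset.filter_coe, Multiset.coe_card]
  congr

theorem countWhere_of_perm {α : Type*} (P : α → Prop) {l l' : List α} {n : ℕ} {a : α}
    (h : l'.Perm (List.replicate n a ++ l)) [Decidable (P a)] :
    countWhere P l' = countWhere P l + if P a then n else 0 := by
  rw [countWhere, countWhere, h.countP_eq, List.countP_append, List.countP_replicate, add_comm]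
  simp

theorem exists_injective_of_infinite (ι X : Type*) [Countable ι] [Infinite X] :
    ∃ e : ι → X, Function.Injective e := by
  obtain ⟨f, hf⟩ := exists_injective_nat ι
  exact ⟨fun i => Infinite.natEmbedding X (f i), (Infinite.natEmbedding X).injective.comp hf⟩

theorem pairwise_iff_monotone_ofFn {α β : Type*} [Preorder β] {n : ℕ} (F : Fin n → α)
    (f : α → β) : (List.ofFn F).Pairwise (fun s t => f s ≤ f t) ↔ Monotone fun i => f (F i) := by
  rw [List.pairwise_ofFn]
  exact monotone_iff_forall_lt.symm

theorem exists_ofFn_eq {α : Type*} (l : List α) : ∃ (n : ℕ) (F : Fin n → α), List.ofFn F = l :=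
  ⟨l.length, l.get, List.ofFn_get l⟩

/-- The key by which the values of the coefficient variables are sorted. -/
def coeffKey (q : Grig × Short) : Lex (Short × (Grig ⧸ K)) := toLex (q.2, QuotientGroup.mk q.1)

/-- The key by which the values of the pairs of commutator variables are sorted. -/
def commKey (p : Grig × Grig) : Lex ((Grig ⧸ K) × (Grig ⧸ K)) :=
  toLex (QuotientGroup.mk p.1, QuotientGroup.mk p.2)

/-- The value of the factor `z⁻¹ c z`. -/
def coeffVal (q : Grig × Short) : Grig := pairConj (q.1, (q.2 : Grig))

/-- The number of factors with a given code index among the coefficient factors. -/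
noncomputable def coeffCount (q : List (Grig × Short)) (u : (Grig ⧸ K) × Short) : ℕ :=
  countWhere (fun s => (QuotientGroup.mk s.1 : Grig ⧸ K) = u.1 ∧ s.2 = u.2) q

/-- The number of commutators with a given code index. -/
noncomputable def commCount (p : List (Grig × Grig)) (u : (Grig ⧸ K) × (Grig ⧸ K)) : ℕ :=
  countWhere
    (fun s => (QuotientGroup.mk s.1 : Grig ⧸ K) = u.1 ∧ (QuotientGroup.mk s.2 : Grig ⧸ K) = u.2) p

/-- The number of squares with a given code index. -/
noncomputable def sqCount (p : List Grig) (u : Grig ⧸ K) : ℕ :=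
  countWhere (fun s => (QuotientGroup.mk s : Grig ⧸ K) = u) p

/-- A homomorphism that is the identity on `Γ` is determined by its values on the variables, and the
constraint can be read off from those values. So variables and constraint can be dropped; conversely
an infinite `X` supplies enough distinct variables for any lists. -/
theorem mem_codes_iff {X : Type*} [Infinite X] [LinearOrder (Grig ⧸ K)]
    [LinearOrder Short] {f : B → ℕ} :
    f ∈ codes X ↔ ∃ (p : List (Grig × Grig)) (q : List (Grig × Short)),
      p.Pairwise (fun s t => commKey s ≤ commKey t) ∧
      q.Pairwise (fun s t => coeffKey s ≤ coeffKey t) ∧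
      (p.map pairComm).prod * (q.map coeffVal).prod = 1 ∧
      Sum.elim (commCount p) (coeffCount q) = f := by
  constructor
  · rintro ⟨E, ⟨hp, hq⟩, ⟨α, hα, h1, hγ⟩, rfl⟩
    rw [E.Q.map_wordVal hα] at h1
    have hx : ∀ i, E.gx i = QuotientGroup.mk (varVal α (E.Q.x i)) := fun i => (hγ _).symm
    have hy : ∀ i, E.gy i = QuotientGroup.mk (varVal α (E.Q.y i)) := fun i => (hγ _).symm
    have hz : ∀ i, E.gz i = QuotientGroup.mk (varVal α (E.Q.z i)) := fun i => (hγ _).symm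
    simp only [hx, hy, hz] at hp hq
    refine ⟨List.ofFn fun i => (varVal α (E.Q.x i), varVal α (E.Q.y i)),
      List.ofFn fun i => (varVal α (E.Q.z i), E.c i),
      (pairwise_iff_monotone_ofFn _ _).2 hp, (pairwise_iff_monotone_ofFn _ _).2 hq, ?_, ?_⟩
    · rw [List.map_ofFn, List.map_ofFn]
      exact h1
    · funext u
      rcases u with ⟨g, h⟩ | ⟨g, c⟩
      · simp only [OrientableEq.code, hx, hy]
        exact (card_subtype_eq_countWhere_ofFn (fun i => (varVal α (E.Q.x i), varVal α (E.Q.y i)))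
          fun s => QuotientGroup.mk s.1 = g ∧ QuotientGroup.mk s.2 = h).symm
      · simp only [OrientableEq.code, hz]
        exact (card_subtype_eq_countWhere_ofFn (fun i => (varVal α (E.Q.z i), E.c i))
          fun s => QuotientGroup.mk s.1 = g ∧ s.2 = c).symm
  · rintro ⟨p, q, hp, hq, h1, rfl⟩
    obtain ⟨n, F, rfl⟩ := exists_ofFn_eq p
    obtain ⟨m, H, rfl⟩ := exists_ofFn_eq q
    rw [pairwise_iff_monotone_ofFn] at hp hq
    obtain ⟨e, he⟩ := exists_injective_of_infinite (Fin n ⊕ (Fin n ⊕ Fin m)) X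
    -- The value `1` off the range of `e` is immaterial: those variables do not occur.
    let val : X → Grig := Function.extend e
      (Sum.elim (fun i => (F i).1) (Sum.elim (fun i => (F i).2) fun i => (H i).1)) 1
    have hval : ∀ j, val (e j) = _ := fun j => he.extend_apply _ _ j
    let E : OrientableEq X :=
      { Q :=
          { genus := n
            numCoeff := m
            x := fun i => e (.inl i)
            y := fun i => e (.inr (.inl i))
            z := fun i => e (.inr (.inr i))
            coeff := fun i => (H i).2
            distinct := by
              convert he using 1
              ext (i | i | i) <;> rfl }
        short := fun i => (H i).2.2
        γ := fun v => QuotientGroup.mk (val v) }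
    have hx : ∀ i, E.gx i = QuotientGroup.mk (F i).1 :=
      fun i => congrArg QuotientGroup.mk (hval (.inl i))
    have hy : ∀ i, E.gy i = QuotientGroup.mk (F i).2 :=
      fun i => congrArg QuotientGroup.mk (hval (.inr (.inl i)))
    have hz : ∀ i, E.gz i = QuotientGroup.mk (H i).1 :=
      fun i => congrArg QuotientGroup.mk (hval (.inr (.inr i)))
    refine ⟨E, ⟨?_, ?_⟩, ⟨homOfVal val, homOfVal_inl val, ?_, fun v => ?_⟩, ?_⟩
    · simp only [hx, hy]
      exact hp
    · simp only [hz]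
      exact hq
    · rw [E.Q.map_wordVal (homOfVal_inl val), ← h1, List.map_ofFn, List.map_ofFn]
      simp only [varVal_homOfVal, E, hval, Sum.elim_inl, Sum.elim_inr]
      rfl
    · exact congrArg QuotientGroup.mk (varVal_homOfVal val v)
    · funext u
      rcases u with ⟨g, h⟩ | ⟨g, c⟩
      · simp only [OrientableEq.code, hx, hy]
        exact card_subtype_eq_countWhere_ofFn F
          fun s => QuotientGroup.mk s.1 = g ∧ QuotientGroup.mk s.2 = h
      · simp only [OrientableEq.code, hz]
        exact card_subtype_eq_countWhere_ofFn H fun s => QuotientGroup.mk s.1 = g ∧ s.2 = c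

theorem mem_codes'_iff {X : Type*} [Infinite X] [LinearOrder (Grig ⧸ K)]
    [LinearOrder Short] {f : B' → ℕ} :
    f ∈ codes' X ↔ ∃ (p : List Grig) (q : List (Grig × Short)), p ≠ [] ∧
      p.Pairwise (fun s t => (QuotientGroup.mk s : Grig ⧸ K) ≤ QuotientGroup.mk t) ∧
      q.Pairwise (fun s t => coeffKey s ≤ coeffKey t) ∧
      (p.map fun s => s ^ 2).prod * (q.map coeffVal).prod = 1 ∧
      Sum.elim (sqCount p) (coeffCount q) = f := by
  constructor
  · rintro ⟨E, ⟨hp, hq⟩, ⟨α, hα, h1, hγ⟩, rfl⟩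
    rw [E.Q.map_wordVal hα] at h1
    have hx : ∀ i, E.gx i = QuotientGroup.mk (varVal α (E.Q.x i)) := fun i => (hγ _).symm
    have hz : ∀ i, E.gz i = QuotientGroup.mk (varVal α (E.Q.z i)) := fun i => (hγ _).symm
    simp only [hx, hz] at hp hq
    refine ⟨List.ofFn fun i => varVal α (E.Q.x i),
      List.ofFn fun i => (varVal α (E.Q.z i), E.c i), ?_,
      (pairwise_iff_monotone_ofFn _ _).2 hp, (pairwise_iff_monotone_ofFn _ _).2 hq, ?_, ?_⟩
    · rw [Ne, List.ofFn_eq_nil_iff]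
      exact E.Q.genus_pos.ne'
    · rw [List.map_ofFn, List.map_ofFn]
      exact h1
    · funext u
      rcases u with g | ⟨g, c⟩
      · simp only [NonorientableEq.code, hx]
        exact (card_subtype_eq_countWhere_ofFn (fun i => varVal α (E.Q.x i))
          fun s => QuotientGroup.mk s = g).symm
      · simp only [NonorientableEq.code, hz]
        exact (card_subtype_eq_countWhere_ofFn (fun i => (varVal α (E.Q.z i), E.c i))
          fun s => QuotientGroup.mk s.1 = g ∧ s.2 = c).symm
  · rintro ⟨p, q, hne, hp, hq, h1, rfl⟩
    obtain ⟨n, F, rfl⟩ := exists_ofFn_eq p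
    obtain ⟨m, H, rfl⟩ := exists_ofFn_eq q
    rw [pairwise_iff_monotone_ofFn] at hp hq
    obtain ⟨e, he⟩ := exists_injective_of_infinite (Fin n ⊕ Fin m) X
    let val : X → Grig := Function.extend e (Sum.elim F fun i => (H i).1) 1
    have hval : ∀ j, val (e j) = _ := fun j => he.extend_apply _ _ j
    let E : NonorientableEq X :=
      { Q :=
          { genus := n
            genus_pos := Nat.pos_of_ne_zero fun h => hne (List.ofFn_eq_nil_iff.2 h)
            numCoeff := m
            x := fun i => e (.inl i)
            z := fun i => e (.inr i)
            coeff := fun i => (H i).2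
            distinct := by
              convert he using 1
              ext (i | i) <;> rfl }
        short := fun i => (H i).2.2
        γ := fun v => QuotientGroup.mk (val v) }
    have hx : ∀ i, E.gx i = QuotientGroup.mk (F i) :=
      fun i => congrArg QuotientGroup.mk (hval (.inl i))
    have hz : ∀ i, E.gz i = QuotientGroup.mk (H i).1 :=
      fun i => congrArg QuotientGroup.mk (hval (.inr i))
    refine ⟨E, ⟨?_, ?_⟩, ⟨homOfVal val, homOfVal_inl val, ?_, fun v => ?_⟩, ?_⟩
    · simp only [hx]
      exact hp
    · simp only [hz]
      exact hq
    · rw [E.Q.map_wordVal (homOfVal_inl val), ← h1, List.map_ofFn, List.map_ofFn]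
      simp only [varVal_homOfVal, E, hval, Sum.elim_inl, Sum.elim_inr]
      rfl
    · exact congrArg QuotientGroup.mk (varVal_homOfVal val v)
    · funext u
      rcases u with g | ⟨g, c⟩
      · simp only [NonorientableEq.code, hx]
        exact card_subtype_eq_countWhere_ofFn F fun s => QuotientGroup.mk s = g
      · simp only [NonorientableEq.code, hz]
        exact card_subtype_eq_countWhere_ofFn H fun s => QuotientGroup.mk s.1 = g ∧ s.2 = c

/-! ### Insertion of blocks of equal factors -/

theorem exists_append_of_pairwise_le {α β : Type*} [LinearOrder β] (f : α → β) {l : List α}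
    (hl : l.Pairwise fun s t => f s ≤ f t) (b : β) :
    ∃ l₁ l₂, l = l₁ ++ l₂ ∧ (∀ s ∈ l₁, f s ≤ b) ∧ ∀ s ∈ l₂, b ≤ f s := by
  induction l with
  | nil => exact ⟨[], [], rfl, by simp, by simp⟩
  | cons a l ih =>
    rw [List.pairwise_cons] at hl
    rcases le_total (f a) b with h | h
    · obtain ⟨l₁, l₂, rfl, h₁, h₂⟩ := ih hl.2
      exact ⟨a :: l₁, l₂, rfl, List.forall_mem_cons.2 ⟨h, h₁⟩, h₂⟩
    · exact ⟨[], a :: l, rfl, by simp,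
        List.forall_mem_cons.2 ⟨h, fun s hs => h.trans (hl.1 s hs)⟩⟩

/-- A block of `n` equal elements can be inserted in a sorted list at a place where the list remains
sorted; this does not change a product if the `n`-th power of the new factor is trivial. -/
theorem exists_perm_replicate_append {α β M : Type*} [LinearOrder β] [Monoid M] (f : α → β)
    (φ : α → M) {l : List α} (hl : l.Pairwise fun s t => f s ≤ f t) (a : α) {n : ℕ}
    (ha : φ a ^ n = 1) :
    ∃ l' : List α, l'.Pairwise (fun s t => f s ≤ f t) ∧ l'.Perm (List.replicate n a ++ l) ∧
      (l'.map φ).prod = (l.map φ).prod := by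
  obtain ⟨l₁, l₂, rfl, h₁, h₂⟩ := exists_append_of_pairwise_le f hl (f a)
  rw [List.pairwise_append] at hl
  refine ⟨l₁ ++ (List.replicate n a ++ l₂), ?_, ?_, ?_⟩
  · rw [List.pairwise_append, List.pairwise_append]
    refine ⟨hl.1, ⟨List.pairwise_replicate.2 (Or.inr le_rfl), hl.2.1, ?_⟩, ?_⟩
    · intro s hs t ht
      rw [List.eq_of_mem_replicate hs]
      exact h₂ t ht
    · intro s hs t ht
      rcases List.mem_append.1 ht with ht | ht
      · rw [List.eq_of_mem_replicate ht]
        exact h₁ s hs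
      · exact hl.2.2 s hs t ht
  · rw [← List.append_assoc, ← List.append_assoc]
    exact List.perm_append_comm.append_right l₂
  · simp [ha]

theorem coeffCount_of_perm {q q' : List (Grig × Short)} {n : ℕ} {a : Grig × Short}
    (h : q'.Perm (List.replicate n a ++ q)) (u : (Grig ⧸ K) × Short) [Decidable (u = (↑a.1, a.2))] :
    coeffCount q' u = coeffCount q u + if u = (↑a.1, a.2) then n else 0 := by
  classical
  rw [coeffCount, countWhere_of_perm _ h]
  simp only [coeffCount, Prod.ext_iff, eq_comm]

theorem commCount_of_perm {p p' : List (Grig × Grig)} {n : ℕ} {a : Grig × Grig}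
    (h : p'.Perm (List.replicate n a ++ p)) (u : (Grig ⧸ K) × (Grig ⧸ K))
    [Decidable (u = (↑a.1, ↑a.2))] :
    commCount p' u = commCount p u + if u = (↑a.1, ↑a.2) then n else 0 := by
  classical
  rw [commCount, countWhere_of_perm _ h]
  simp only [commCount, Prod.ext_iff, eq_comm]

theorem sqCount_of_perm {p p' : List Grig} {n : ℕ} {a : Grig}
    (h : p'.Perm (List.replicate n a ++ p)) (u : Grig ⧸ K) [Decidable (u = ↑a)] :
    sqCount p' u = sqCount p u + if u = ↑a then n else 0 := by
  classical
  rw [sqCount, countWhere_of_perm _ h]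
  simp only [sqCount, eq_comm]

theorem coeffVal_pow_orderOf (g : Grig) (c : Short) : coeffVal (g, c) ^ orderOf (c : Grig) = 1 := by
  have h := conj_pow (i := orderOf (c : Grig)) (a := g⁻¹) (b := (c : Grig))
  rw [inv_inv, pow_orderOf_eq_one] at h
  rw [coeffVal, pairConj, h]
  group

/-- The orders that define the cone in the orientable case. -/
noncomputable def basicOrder (r : Grig ⧸ K → Grig) : B → ℕ
  | .inl (g, h) => orderOf (pairComm (r g, r h))
  | .inr (_, c) => orderOf (c : Grig)

/-- The orders that define the cone in the non-orientable case. -/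
noncomputable def basicOrder' (r : Grig ⧸ K → Grig) : B' → ℕ
  | .inl g => orderOf (r g ^ 2)
  | .inr (_, c) => orderOf (c : Grig)

/-- Torsion enters here: an order `0` would remove a direction from the cone and leave infinitely
many residue classes. -/
theorem basicOrder_pos (r : Grig ⧸ K → Grig) (u : B) : 0 < basicOrder r u := by
  rcases u with _ | _ <;> exact (Grig.isOfFinOrder _).orderOf_pos

theorem basicOrder'_pos (r : Grig ⧸ K → Grig) (u : B') : 0 < basicOrder' r u := by
  rcases u with _ | _ <;> exact (Grig.isOfFinOrder _).orderOf_pos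

open Classical in
theorem cone_eq (r : Grig ⧸ K → Grig) :
    cone r = AddSubmonoid.closure
      (Set.range fun u => (Pi.single u (basicOrder r u) : B → ℕ)) := by
  rw [cone]
  congr 2
  funext u
  rcases u with ⟨g, h⟩ | ⟨g, c⟩ <;> rfl

open Classical in
theorem cone'_eq (r : Grig ⧸ K → Grig) :
    cone' r = AddSubmonoid.closure
      (Set.range fun u => (Pi.single u (basicOrder' r u) : B' → ℕ)) := by
  rw [cone']
  congr 2
  funext u
  rcases u with g | ⟨g, c⟩ <;> rfl

open Classical in
-- The inserted block is evaluated at representatives, so by `hr` it is counted at the index `u`.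
-- For a coefficient factor any representative works, since conjugation preserves the order.
theorem add_single_mem_codes {X : Type*} [Infinite X] [LinearOrder (Grig ⧸ K)]
    [LinearOrder Short] {r : Grig ⧸ K → Grig} (hr : ∀ h, (QuotientGroup.mk (r h) : Grig ⧸ K) = h)
    {f : B → ℕ} (hf : f ∈ codes X) (u : B) : f + Pi.single u (basicOrder r u) ∈ codes X := by
  rw [mem_codes_iff] at hf ⊢
  obtain ⟨p, q, hp, hq, h1, rfl⟩ := hf
  rcases u with ⟨g, h⟩ | ⟨g, c⟩
  · obtain ⟨p', hp', hperm, hprod⟩ := exists_perm_replicate_append commKey pairComm hp (r g, r h)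
      (pow_orderOf_eq_one _)
    refine ⟨p', q, hp', hq, by rw [hprod, h1], ?_⟩
    funext u
    rcases u with u | u
    · simp [commCount_of_perm hperm, hr, Pi.single_apply, basicOrder]
    · simp
  · obtain ⟨q', hq', hperm, hprod⟩ := exists_perm_replicate_append coeffKey coeffVal hq (r g, c)
      (coeffVal_pow_orderOf _ c)
    refine ⟨p, q', hp, hq', by rw [hprod, h1], ?_⟩
    funext u
    rcases u with u | u
    · simp
    · simp [coeffCount_of_perm hperm, hr, Pi.single_apply, basicOrder]

open Classical in
theorem add_single_mem_codes' {X : Type*} [Infinite X] [LinearOrder (Grig ⧸ K)]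
    [LinearOrder Short] {r : Grig ⧸ K → Grig} (hr : ∀ h, (QuotientGroup.mk (r h) : Grig ⧸ K) = h)
    {f : B' → ℕ} (hf : f ∈ codes' X) (u : B') :
    f + Pi.single u (basicOrder' r u) ∈ codes' X := by
  rw [mem_codes'_iff] at hf ⊢
  obtain ⟨p, q, hne, hp, hq, h1, rfl⟩ := hf
  rcases u with g | ⟨g, c⟩
  · obtain ⟨p', hp', hperm, hprod⟩ := exists_perm_replicate_append
      (QuotientGroup.mk : Grig → Grig ⧸ K) (fun s => s ^ 2) hp (r g) (pow_orderOf_eq_one _)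
    refine ⟨p', q, ?_, hp', hq, by rw [hprod, h1], ?_⟩
    · rintro rfl
      exact hne (List.append_eq_nil_iff.1 hperm.nil_eq.symm).2
    funext u
    rcases u with u | u
    · simp [sqCount_of_perm hperm, hr, Pi.single_apply, basicOrder']
    · simp
  · obtain ⟨q', hq', hperm, hprod⟩ := exists_perm_replicate_append coeffKey coeffVal hq (r g, c)
      (coeffVal_pow_orderOf _ c)
    refine ⟨p, q', hne, hp, hq', by rw [hprod, h1], ?_⟩
    funext u
    rcases u with u | u
    · simp
    · simp [coeffCount_of_perm hperm, hr, Pi.single_apply, basicOrder']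

end GrigorchukEq

theorem mainTheorem5 {X : Type*} [Countable X] [Infinite X]
    [LinearOrder (GrigorchukEq.Grig ⧸ GrigorchukEq.K)] [LinearOrder GrigorchukEq.Short]
    (r : GrigorchukEq.Grig ⧸ GrigorchukEq.K → GrigorchukEq.Grig)
    (hr : ∀ h, (QuotientGroup.mk (r h) : GrigorchukEq.Grig ⧸ GrigorchukEq.K) = h) :
    ((∃ (m : ℕ) (v : Fin m → GrigorchukEq.B → ℕ),
        GrigorchukEq.codes X =
          ⋃ i, (fun l => v i + l) '' (GrigorchukEq.cone r : Set (GrigorchukEq.B → ℕ))) ∧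
      GrigorchukEq.IsRecursive (GrigorchukEq.codes X)) ∧
    ((∃ (m : ℕ) (v : Fin m → GrigorchukEq.B' → ℕ),
        GrigorchukEq.codes' X =
          ⋃ i, (fun l => v i + l) '' (GrigorchukEq.cone' r : Set (GrigorchukEq.B' → ℕ))) ∧
      GrigorchukEq.IsRecursive (GrigorchukEq.codes' X)) := by
  classical
  obtain ⟨m, v, h⟩ := GrigorchukEq.exists_eq_iUnion_image_add
    (GrigorchukEq.basicOrder_pos r) (P := GrigorchukEq.codes X)
    fun _ hf u => GrigorchukEq.add_single_mem_codes hr hf u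
  obtain ⟨m', v', h'⟩ := GrigorchukEq.exists_eq_iUnion_image_add
    (GrigorchukEq.basicOrder'_pos r) (P := GrigorchukEq.codes' X)
    fun _ hf u => GrigorchukEq.add_single_mem_codes' hr hf u
  refine ⟨⟨⟨m, v, ?_⟩, ?_⟩, ⟨m', v', ?_⟩, ?_⟩
  · rw [GrigorchukEq.cone_eq]
    -- The two sides can differ only in the instances of decidable equality inside `Pi.single`.
    convert h
  · rw [h]
    exact GrigorchukEq.isRecursive_iUnion_image_add _ v
  · rw [GrigorchukEq.cone'_eq]
    convert h'
  · rw [h']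
    exact GrigorchukEq.isRecursive_iUnion_image_add _ v'
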